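/- Let $\Sigma$ be a finite alphabet. A deterministic complete semi-automaton $\mathcal A=(\Sigma,Q,\delta)$ consists of a finite state set $Q$ and a total transition function $\delta\colon Q\times\Sigma\to Q$, extended to words in the usual way. It is called commutative if $\delta(q,ab)=\delta(q,ba)$ for all $q\in Q$ and $a,b\in\Sigma$. A word $w\in\Sigma^*$ is synchronizing for $\mathcal A$ if $|\{\delta(q,w) : q\in Q\}|=1$. **Theorem.** Fix a regular language $L\subseteq\Sigma^*$. The following problem is solvable in polynomial time: given a commutative deterministic complete semi-automaton $\mathcal A$ over $\Sigma$ with $n$ states (by its transition table), decide whether $\mathcal A$ has a synchronizing word in $L$. Moreover, the degree of the polynomial can be chosen to depend only on $|\Sigma|$. That is, there is a function $d\colon\mathbb N\to\mathbb N$ such that for every finite alphabet $\Sigma$ and every regular $L\subseteq\Sigma^*$ there are a constant $C$ and a deterministic Turing machine which, on every commutative input semi-automaton over $\Sigma$ with $n$ states, halts with the correct answer after at most $C\,(n+1)^{d(|\Sigma|)}$ steps. -/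

import Mathlib

/-- A deterministic and complete semi-automaton with input alphabet `α` and state set `Q`:
an automaton without start state and without final states. -/
structure SemiAutomaton (α : Type*) (Q : Type*) where
  /-- The (total) transition function. -/
  step : Q → α → Q

namespace SemiAutomaton

/-- The extension of the transition function to words. -/
def run {α Q : Type*} (A : SemiAutomaton α Q) (q : Q) (w : List α) : Q :=
  w.foldl A.step q

/-- `A` is commutative if `δ(q, ab) = δ(q, ba)` for all states `q` and letters `a`, `b`. -/
def IsCommutative {α Q : Type*} (A : SemiAutomaton α Q) : Prop :=
  ∀ (q : Q) (a b : α), A.run q [a, b] = A.run q [b, a]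

/-- `w` is a synchronizing word for `A`: the set `δ(Q, w)` has exactly one element. -/
def IsSyncWord {α Q : Type*} (A : SemiAutomaton α Q) (w : List α) : Prop :=
  (Set.range fun q : Q => A.run q w).ncard = 1

/-- The constrained synchronization problem: has `A` a synchronizing word in `L`? -/
def HasSyncWordIn {α Q : Type*} (A : SemiAutomaton α Q) (L : Language α) : Prop :=
  ∃ w : List α, w ∈ L ∧ A.IsSyncWord w

/-- The input word presenting a semi-automaton with states `0, …, n - 1`, where `e` lists the
letters: first `n`, then the transition table, row by row (one row for each state, one entry for
each letter). Each number `m` is written as `1ᵐ0`. This word has length at most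
`(n + 1) * (k * n + 1)`. -/
def encode {α : Type*} {k n : ℕ} (e : Fin k ≃ α) (A : SemiAutomaton α (Fin n)) : List Bool :=
  List.replicate n true ++ [false] ++
    (List.finRange n).flatMap fun q =>
      (List.finRange k).flatMap fun i =>
        List.replicate (A.step q (e i) : ℕ) true ++ [false]

end SemiAutomaton

/-- A deterministic Turing machine (in Mathlib's multi-stack model) over the input and output
alphabet `Bool`. Its sets of stacks, labels and internal states are finite by definition; here all
its stack alphabets are required to be finite as well. -/
structure BoolTuringMachine extends Turing.TM2ComputableAux Bool Bool where
  /-- Every stack alphabet is finite. -/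
  finite_alphabet : ∀ i : tm.K, Finite (tm.Γ i)

/-- Started on the input word `x`, the machine `M` halts after at most `t` steps
with the one-symbol output `b`. -/
def BoolTuringMachine.AnswersInTime (M : BoolTuringMachine) (x : List Bool) (b : Bool) (t : ℕ) :
    Prop :=
  Nonempty (Turing.TM2OutputsInTime M.tm (x.map M.inputAlphabet.symm)
    (some ([b].map M.outputAlphabet.symm)) t)

/-! In a commutative semi-automaton the action of a word depends only on its letter counts. With `n`
states, even these matter only up to `n`. If `w` synchronizes to `s` and commutes with `a`, then `s`
is fixed by `a`. An orbit of `a` that reaches a fixed point does so within `n` steps, so surplus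
copies of `a` can be erased (`IsSyncWord.erase`, `IsSyncWord.of_count_le`). Extra letters never
destroy synchronization (`IsSyncWord.of_subperm`).

Let `D` be the set of count vectors dominated by the counts of some word of `L`. It is closed
downwards, so by Dickson's lemma there is a threshold `N`, depending on `L` alone, such that a
vector lies in `D` as soon as its truncation at `N` does (`IsLowerSet.exists_truncation`). Each of
the finitely many `m ∈ D` with entries at most `N` gives a test word: `m a` copies of `a`, and `n`
further ones when `m a = N`. Some word of `L` synchronizes exactly when one of these test words does
(`exists_patterns`).

The list of patterns is built into the machine. Applying a letter to a set of states takes one pass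
over the table, quadratic in `n`. An `n`-th power takes `n` passes, hence the exponent 3 for every
alphabet. Time bounds are proved for structured programs and transferred to stack machines by
`Runs.evalsToInTime`. -/

/-! ### Structured programs and their translation to stack machines -/

/-- Structured programs acting on finitely many stacks of bits, indexed by `K`, and on an internal
memory `σ`. -/
inductive StackProgram (K σ : Type)
  | pop (k : K) (f : σ → Option Bool → σ)
  | push (k : K) (f : σ → Bool)
  | load (f : σ → σ)
  | seq (p q : StackProgram K σ)
  | ite (b : σ → Bool) (p q : StackProgram K σ)
  | loop (b : σ → Bool) (p : StackProgram K σ)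

namespace StackProgram

open Turing Turing.TM2 StateTransition

variable {K σ : Type}

/-- `p.Runs v S v' S' t`: started with memory `v` and stacks `S`, the program `p` terminates within
time `t` with memory `v'` and stacks `S'`. -/
inductive Runs [DecidableEq K] :
    StackProgram K σ → σ → (K → List Bool) → σ → (K → List Bool) → ℕ → Prop
  | pop (k : K) (f : σ → Option Bool → σ) (v : σ) (S : K → List Bool) :
      Runs (.pop k f) v S (f v (S k).head?) (Function.update S k (S k).tail) 1
  | push (k : K) (f : σ → Bool) (v : σ) (S : K → List Bool) :
      Runs (.push k f) v S v (Function.update S k (f v :: S k)) 1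
  | load (f : σ → σ) (v : σ) (S : K → List Bool) : Runs (.load f) v S (f v) S 1
  | seq {p q : StackProgram K σ} {v v' v'' : σ} {S S' S'' : K → List Bool} {t t' : ℕ} :
      Runs p v S v' S' t → Runs q v' S' v'' S'' t' → Runs (.seq p q) v S v'' S'' (t + t')
  | ite_true {b : σ → Bool} {p : StackProgram K σ} (q : StackProgram K σ) {v v' : σ}
      {S S' : K → List Bool} {t : ℕ} :
      b v = true → Runs p v S v' S' t → Runs (.ite b p q) v S v' S' (t + 1)
  | ite_false {b : σ → Bool} (p : StackProgram K σ) {q : StackProgram K σ} {v v' : σ}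
      {S S' : K → List Bool} {t : ℕ} :
      b v = false → Runs q v S v' S' t → Runs (.ite b p q) v S v' S' (t + 1)
  | loop_false {b : σ → Bool} (p : StackProgram K σ) {v : σ} (S : K → List Bool) :
      b v = false → Runs (.loop b p) v S v S 1
  | loop_true {b : σ → Bool} {p : StackProgram K σ} {v v' v'' : σ} {S S' S'' : K → List Bool}
      {t t' : ℕ} :
      b v = true → Runs p v S v' S' t → Runs (.loop b p) v' S' v'' S'' t' →
        Runs (.loop b p) v S v'' S'' (t + t' + 1)
  | mono {p : StackProgram K σ} {v v' : σ} {S S' : K → List Bool} {t t' : ℕ} :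
      Runs p v S v' S' t → t ≤ t' → Runs p v S v' S' t'

/-- The labels needed to translate a program. -/
def Label : StackProgram K σ → Type
  | pop _ _ | push _ _ | load _ => Unit
  | seq p q => p.Label ⊕ q.Label
  | ite _ p q => Option (p.Label ⊕ q.Label)
  | loop _ p => Option p.Label

/-- There are finitely many labels. -/
instance labelFintype : (p : StackProgram K σ) → Fintype p.Label
  | pop _ _ | push _ _ | load _ => inferInstanceAs (Fintype Unit)
  | seq p q =>
    letI := labelFintype p
    letI := labelFintype q
    inferInstanceAs (Fintype (p.Label ⊕ q.Label))
  | ite _ p q =>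
    letI := labelFintype p
    letI := labelFintype q
    inferInstanceAs (Fintype (Option (p.Label ⊕ q.Label)))
  | loop _ p =>
    letI := labelFintype p
    inferInstanceAs (Fintype (Option p.Label))

/-- The label at which a program starts. -/
def entry : (p : StackProgram K σ) → p.Label
  | pop _ _ | push _ _ | load _ => ()
  | seq p _ => Sum.inl p.entry
  | ite _ _ _ | loop _ _ => none

/-- The statements of the translation of a program whose labels are embedded by `ι`, and which
continues at the label `x`. -/
def code {Λ : Type} : (p : StackProgram K σ) → (p.Label → Λ) → Λ → p.Label →
    Stmt (fun _ : K => Bool) Λ σ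
  | pop k f, _, x, _ => .pop k f (.goto fun _ => x)
  | push k f, _, x, _ => .push k f (.goto fun _ => x)
  | load f, _, x, _ => .load f (.goto fun _ => x)
  | seq p q, ι, _, .inl l => p.code (fun l => ι (.inl l)) (ι (.inr q.entry)) l
  | seq _ q, ι, x, .inr l => q.code (fun l => ι (.inr l)) x l
  | ite b p q, ι, _, none =>
      .branch b (.goto fun _ => ι (some (.inl p.entry))) (.goto fun _ => ι (some (.inr q.entry)))
  | ite _ p _, ι, x, some (.inl l) => p.code (fun l => ι (some (.inl l))) x l
  | ite _ _ q, ι, x, some (.inr l) => q.code (fun l => ι (some (.inr l))) x l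
  | loop b p, ι, x, none => .branch b (.goto fun _ => ι (some p.entry)) (.goto fun _ => x)
  -- The body exits to the test of its own loop.
  | loop _ p, ι, _, some l => p.code (fun l => ι (some l)) (ι none) l

theorem evalsToInTime_mono {τ : Type*} {f : τ → Option τ} {a : τ} {b : Option τ} {m n : ℕ}
    (h : Nonempty (EvalsToInTime f a b m)) (hmn : m ≤ n) : Nonempty (EvalsToInTime f a b n) :=
  h.map fun h => ⟨h.toEvalsTo, h.steps_le_m.trans hmn⟩

theorem evalsToInTime_trans {τ : Type*} {f : τ → Option τ} {a b : τ} {c : Option τ} {m n : ℕ}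
    (h : Nonempty (EvalsToInTime f a (some b) m)) (h' : Nonempty (EvalsToInTime f b c n)) :
    Nonempty (EvalsToInTime f a c (m + n)) := by
  obtain ⟨h⟩ := h
  obtain ⟨h'⟩ := h'
  rw [add_comm]
  exact ⟨EvalsToInTime.trans f m n a b c h h'⟩

theorem evalsToInTime_one {τ : Type*} {f : τ → Option τ} {a : τ} {b : Option τ} (h : f a = b) :
    Nonempty (EvalsToInTime f a b 1) :=
  ⟨⟨⟨1, h⟩, le_rfl⟩⟩

theorem step_eq [DecidableEq K] {Λ : Type} {m : Λ → Stmt (fun _ : K => Bool) Λ σ} {l : Λ}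
    {q : Stmt (fun _ : K => Bool) Λ σ} {v : σ} {S : K → List Bool}
    {c : Cfg (fun _ : K => Bool) Λ σ} (h : m l = q) (hc : stepAux q v S = c) :
    TM2.step m ⟨some l, v, S⟩ = some c := by
  rw [TM2.step, h, hc]

/-- The translation of a program to a stack machine is correct. -/
theorem Runs.evalsToInTime [DecidableEq K] {p : StackProgram K σ} {v v' : σ}
    {S S' : K → List Bool} {t : ℕ} (h : p.Runs v S v' S' t) {Λ : Type}
    {m : Λ → Stmt (fun _ : K => Bool) Λ σ} (ι : p.Label → Λ) (x : Λ)
    (hm : ∀ l, m (ι l) = p.code ι x l) :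
    Nonempty (EvalsToInTime (TM2.step m) ⟨some (ι p.entry), v, S⟩ (some ⟨some x, v', S'⟩) t) := by
  induction h generalizing x with
  | pop k f v S => exact evalsToInTime_one (by simp [hm, code])
  | push k f v S => exact evalsToInTime_one (by simp [hm, code])
  | load f v S => exact evalsToInTime_one (by simp [hm, code])
  | @seq p q _ _ _ _ _ _ _ _ _ _ ihp ihq =>
    exact evalsToInTime_trans (ihp (fun l => ι (.inl l)) (ι (.inr q.entry)) fun l => hm (.inl l))
      (ihq (fun l => ι (.inr l)) x fun l => hm (.inr l))
  | @ite_true b p q _ _ _ _ t hb _ ih =>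
    rw [add_comm]
    exact evalsToInTime_trans (evalsToInTime_one (step_eq (hm none) (by simp [code, hb])))
      (ih (fun l => ι (some (.inl l))) x fun l => hm (some (.inl l)))
  | @ite_false b p q _ _ _ _ t hb _ ih =>
    rw [add_comm]
    exact evalsToInTime_trans (evalsToInTime_one (step_eq (hm none) (by simp [code, hb])))
      (ih (fun l => ι (some (.inr l))) x fun l => hm (some (.inr l)))
  | loop_false p S hb => exact evalsToInTime_one (step_eq (hm none) (by simp [code, hb]))
  | @loop_true b p _ _ _ _ _ _ t t' hb _ _ ih ih' =>
    rw [add_comm]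
    exact evalsToInTime_trans (evalsToInTime_one (step_eq (hm none) (by simp [code, hb])))
      (evalsToInTime_trans (ih (fun l => ι (some l)) (ι none) fun l => hm (some l)) (ih' ι x hm))
  | mono _ hle ih => exact evalsToInTime_mono (ih ι x hm) hle

/-- The Turing machine running a program, with input and output on the stack `k`. -/
def machine [DecidableEq K] [Fintype K] [Fintype σ] (p : StackProgram K σ) (k : K) (v : σ) :
    BoolTuringMachine where
  tm :=
    letI := p.labelFintype
    { K := K
      k₀ := k
      k₁ := k
      Γ := fun _ => Bool
      Λ := Option p.Label
      main := some p.entry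
      σ := σ
      initialState := v
      Γk₀Fin := inferInstanceAs (Fintype Bool)
      m := fun l => l.elim .halt (p.code some none) }
  inputAlphabet := Equiv.refl Bool
  outputAlphabet := Equiv.refl Bool
  finite_alphabet := fun _ => inferInstanceAs (Finite Bool)

/-- A program run yields a computation of the Turing machine. -/
theorem Runs.answersInTime [DecidableEq K] [Fintype K] [Fintype σ] {p : StackProgram K σ} {k : K}
    {v : σ} {x : List Bool} {b : Bool} {t : ℕ}
    (h : p.Runs v (Function.update (fun _ => []) k x) v (Function.update (fun _ => []) k [b]) t) :
    (p.machine k v).AnswersInTime x b (t + 1) := by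
  have hself : ∀ (j : K) (l : List Bool), Function.update (fun _ => []) j l j = l :=
    fun j l => Function.update_self ..
  have hne : ∀ (i j : K) (l : List Bool), i ≠ j → Function.update (fun _ => []) j l i = [] :=
    fun i j l h => Function.update_of_ne h ..
  have h1 := h.evalsToInTime (m := fun l => l.elim .halt (p.code some none)) some none
    fun l => rfl
  -- The additional step executes `halt` at the exit label.
  have h2 := evalsToInTime_trans h1 (evalsToInTime_one
    (b := some ⟨none, v, Function.update (fun _ => []) k [b]⟩) (by simp))
  have hinit : initList (p.machine k v).tm (x.map (p.machine k v).inputAlphabet.symm) =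
      (⟨some (some p.entry), v, Function.update (fun _ => []) k x⟩ :
        TM2.Cfg (fun _ : K => Bool) (Option p.Label) σ) := by
    refine congrArg (TM2.Cfg.mk _ _) ?_
    refine funext fun j : K => ?_
    rcases eq_or_ne j k with rfl | hj
    · exact (dif_pos rfl).trans ((List.map_id x).trans (hself j x).symm)
    · exact (dif_neg hj).trans (hne j k _ hj).symm
  have hhalt : haltList (p.machine k v).tm ([b].map (p.machine k v).outputAlphabet.symm) =
      (⟨none, v, Function.update (fun _ => []) k [b]⟩ :
        TM2.Cfg (fun _ : K => Bool) (Option p.Label) σ) := by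
    refine congrArg (TM2.Cfg.mk _ _) ?_
    refine funext fun j : K => ?_
    rcases eq_or_ne j k with rfl | hj
    · exact (dif_pos rfl).trans (hself j [b]).symm
    · exact (dif_neg hj).trans (hne j k _ hj).symm
  unfold BoolTuringMachine.AnswersInTime TM2OutputsInTime
  rw [Option.map_some, hinit, hhalt]
  exact h2

end StackProgram

/-! ### Composition rules for timed runs -/

namespace StackProgram

variable {K σ : Type} [DecidableEq K]

theorem Runs.of_eq {p : StackProgram K σ} {v v' v'' : σ} {S S' S'' : K → List Bool} {t t' : ℕ}
    (h : p.Runs v S v' S' t) (hv : v' = v'') (hS : S' = S'') (ht : t ≤ t') :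
    p.Runs v S v'' S'' t' :=
  hv ▸ hS ▸ h.mono ht

theorem Runs.seq_le {p q : StackProgram K σ} {v v' v'' : σ} {S S' S'' : K → List Bool}
    {t t' u : ℕ} (h : p.Runs v S v' S' t) (h' : q.Runs v' S' v'' S'' t') (hu : t + t' ≤ u) :
    (StackProgram.seq p q).Runs v S v'' S'' u :=
  (h.seq h').mono hu

theorem Runs.pop_seq {k : K} {f : σ → Option Bool → σ} {q : StackProgram K σ} {v v' : σ}
    {S S' : K → List Bool} {t : ℕ}
    (h : q.Runs (f v (S k).head?) (Function.update S k (S k).tail) v' S' t) :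
    (StackProgram.seq (.pop k f) q).Runs v S v' S' (t + 1) :=
  (Runs.pop k f v S).seq_le h (by omega)

theorem Runs.push_seq {k : K} {f : σ → Bool} {q : StackProgram K σ} {v v' : σ}
    {S S' : K → List Bool} {t : ℕ}
    (h : q.Runs v (Function.update S k (f v :: S k)) v' S' t) :
    (StackProgram.seq (.push k f) q).Runs v S v' S' (t + 1) :=
  (Runs.push k f v S).seq_le h (by omega)

theorem Runs.load_seq {f : σ → σ} {q : StackProgram K σ} {v v' : σ} {S S' : K → List Bool} {t : ℕ}
    (h : q.Runs (f v) S v' S' t) : (StackProgram.seq (.load f) q).Runs v S v' S' (t + 1) :=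
  (Runs.load f v S).seq_le h (by omega)

end StackProgram

/-! ### Stacks, memory and elementary stack operations -/

namespace SyncMachine

open StackProgram

/-- The stacks: the unread and the read part of the transition table, the number of states in unary
and the part of it that a loop has counted, the current set of states and the next one as bit
lists, and the part of the next one that is above the position in question. -/
inductive Stack
  | table | passed | size | counted | image | next | shift
  deriving DecidableEq

instance : Fintype Stack :=
  ⟨{.table, .passed, .size, .counted, .image, .next, .shift}, fun k => by cases k <;> decide⟩

/-- The internal memory: the last bit that was read, the membership of the current state in the
current set, the control bit of a counting loop, the number of states found in the final set
(`none` for zero, `some true` for one, `some false` for more), and the answer. -/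
structure Memory where
  sym : Option Bool
  bit : Option Bool
  ctr : Option Bool
  hits : Option Bool
  answer : Bool
  deriving DecidableEq, Fintype

/-- The family of stacks with the given contents. -/
def contents (T R N M X Y Z : List Bool) : Stack → List Bool
  | .table => T
  | .passed => R
  | .size => N
  | .counted => M
  | .image => X
  | .next => Y
  | .shift => Z

section contents

variable (T R N M X Y Z l : List Bool)

@[simp] theorem contents_table : contents T R N M X Y Z .table = T := rfl
@[simp] theorem contents_passed : contents T R N M X Y Z .passed = R := rfl
@[simp] theorem contents_size : contents T R N M X Y Z .size = N := rfl
@[simp] theorem contents_counted : contents T R N M X Y Z .counted = M := rfl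
@[simp] theorem contents_image : contents T R N M X Y Z .image = X := rfl
@[simp] theorem contents_next : contents T R N M X Y Z .next = Y := rfl
@[simp] theorem contents_shift : contents T R N M X Y Z .shift = Z := rfl

@[simp] theorem update_table :
    Function.update (contents T R N M X Y Z) .table l = contents l R N M X Y Z := by
  funext k; cases k <;> rfl

@[simp] theorem update_passed :
    Function.update (contents T R N M X Y Z) .passed l = contents T l N M X Y Z := by
  funext k; cases k <;> rfl

@[simp] theorem update_size :
    Function.update (contents T R N M X Y Z) .size l = contents T R l M X Y Z := by
  funext k; cases k <;> rfl

@[simp] theorem update_counted :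
    Function.update (contents T R N M X Y Z) .counted l = contents T R N l X Y Z := by
  funext k; cases k <;> rfl

@[simp] theorem update_image :
    Function.update (contents T R N M X Y Z) .image l = contents T R N M l Y Z := by
  funext k; cases k <;> rfl

@[simp] theorem update_next :
    Function.update (contents T R N M X Y Z) .next l = contents T R N M X l Z := by
  funext k; cases k <;> rfl

@[simp] theorem update_shift :
    Function.update (contents T R N M X Y Z) .shift l = contents T R N M X Y l := by
  funext k; cases k <;> rfl

end contents

/-- Programs on these stacks and this memory. -/
abbrev Program := StackProgram Stack Memory

/-- Pop a symbol. -/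
def getSym (k : Stack) : Program := .pop k fun v s => { v with sym := s }

/-- The loop of `move`. -/
def moveLoop (a b : Stack) : Program :=
  .loop (fun v => v.sym.isSome) (.seq (.push b fun v => v.sym.getD false) (getSym a))

/-- Move the stack `a` onto the stack `b`, reversing it. -/
def move (a b : Stack) : Program := .seq (getSym a) (moveLoop a b)

/-- The guard can only inspect a symbol already popped, so the remaining list `l` is split: its head
is in memory and its tail is on the stack. The later loops that consume a stack use the same
invariant. -/
theorem runs_moveLoop {a b : Stack} (hab : a ≠ b) (l : List Bool) (v : Memory)
    (S : Stack → List Bool) (hS : S a = l.tail) (hv : v.sym = l.head?) :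
    (moveLoop a b).Runs v S { v with sym := none }
      (Function.update (Function.update S a []) b (l.reverse ++ S b)) (3 * l.length + 1) := by
  induction l generalizing v S with
  | nil =>
    refine (Runs.loop_false _ S (by simp [hv])).of_eq ?_ ?_ (by simp)
    · cases v; simp_all
    · have : Function.update S a [] = S := by rw [Function.update_eq_self_iff]; simpa using hS.symm
      simp [this]
  | cons c l ih =>
    refine (Runs.loop_true (t := 2) (by simp [hv]) (Runs.push_seq (Runs.pop _ _ _ _))
      (ih _ _ ?_ ?_)).of_eq rfl ?_ ?_
    · simp [Function.update_of_ne hab, hS]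
    · simp [Function.update_of_ne hab, hS]
    · funext k
      by_cases hb : k = b
      · subst hb; simp [Function.update_of_ne hab.symm, hv]
      · by_cases ha : k = a
        · subst ha; simp [hb]
        · simp [ha, hb]
    · simp only [List.length_cons]; omega

theorem runs_move {a b : Stack} (hab : a ≠ b) (v : Memory) (S : Stack → List Bool) :
    (move a b).Runs v S { v with sym := none }
      (Function.update (Function.update S a []) b ((S a).reverse ++ S b))
      (3 * (S a).length + 2) := by
  refine Runs.pop_seq ((runs_moveLoop hab (S a) _ _ ?_ ?_).of_eq rfl ?_ le_rfl)
  · simp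
  · simp
  · simp [Function.update_of_ne hab.symm]

/-! ### Applying a letter to a set of states -/

/-- The unary block that encodes a number. -/
def block (m : ℕ) : List Bool := List.replicate m true ++ [false]

@[simp] theorem length_block (m : ℕ) : (block m).length = m + 1 := by simp [block]

theorem block_append (m : ℕ) (l : List Bool) :
    block m ++ l = List.replicate m true ++ false :: l := by simp [block]

theorem reverse_block_append (m : ℕ) (l : List Bool) :
    (block m).reverse ++ l = false :: (List.replicate m true ++ l) := by simp [block]

/-- The loop of `skip`. -/
def skipLoop : Program :=
  .loop (fun v => v.sym == some true) (.seq (.push .passed fun _ => true) (getSym .table))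

/-- Pass over a block. -/
def skip : Program :=
  .seq (getSym .table) (.seq skipLoop
    (.seq (.push .passed fun _ => false) (.load fun v => { v with sym := none })))

theorem runs_skipLoop (m : ℕ) (b c h : Option Bool) (r : Bool) (T R N M X Y Z : List Bool) :
    skipLoop.Runs ⟨(List.replicate m true ++ false :: T).head?, b, c, h, r⟩
      (contents (List.replicate m true ++ false :: T).tail R N M X Y Z) ⟨some false, b, c, h, r⟩
      (contents T (List.replicate m true ++ R) N M X Y Z) (3 * m + 1) := by
  induction m generalizing R with
  | zero => exact Runs.loop_false _ _ rfl
  | succ m ih =>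
    refine (Runs.loop_true (t := 2) rfl (Runs.push_seq (Runs.pop _ _ _ _)) ?_).mono
      (t := 2 + (3 * m + 1) + 1) (by omega)
    simp only [update_passed, contents_passed, update_table, contents_table, List.replicate_succ,
      List.cons_append, List.tail_cons]
    refine (ih (true :: R)).of_eq rfl ?_ le_rfl
    -- A `true` pushed below a run of `true`s is the same as one pushed above it.
    rw [List.append_cons, ← List.replicate_succ', List.replicate_succ, List.cons_append]

theorem runs_skip (m : ℕ) (s b c h : Option Bool) (r : Bool) (T R N M X Y Z : List Bool) :
    skip.Runs ⟨s, b, c, h, r⟩ (contents (block m ++ T) R N M X Y Z) ⟨none, b, c, h, r⟩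
      (contents T ((block m).reverse ++ R) N M X Y Z) (3 * m + 4) := by
  rw [block_append, reverse_block_append]
  refine Runs.pop_seq ?_
  simp only [update_table, contents_table]
  refine Runs.seq_le (runs_skipLoop m b c h r T R N M X Y Z) (t' := 2) (Runs.push_seq ?_) le_rfl
  exact (Runs.load _ _ _).of_eq rfl (by simp) le_rfl

/-- The loop of `mark`. -/
def markLoop : Program :=
  .loop (fun v => v.sym == some true) (.seq (.push .passed fun _ => true) (.seq (getSym .next)
    (.seq (.push .shift fun v => v.sym.getD false) (getSym .table))))

/-- Pass over a block and set the bit whose position it encodes. -/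
def mark : Program :=
  .seq (getSym .table) (.seq markLoop (.seq (.push .passed fun _ => false)
    (.seq (getSym .next) (.seq (.push .next fun _ => true) (move .shift .next)))))

/-- Each `true` of the block shifts one bit from `next` to `shift`, so the bit at position `m` comes
to the top. By `hm` the stack `next` never runs out, and the default of `getD` is not used. -/
theorem runs_markLoop (m : ℕ) (b c h : Option Bool) (r : Bool) (T R N M X Y Z : List Bool)
    (hm : m ≤ Y.length) :
    markLoop.Runs ⟨(List.replicate m true ++ false :: T).head?, b, c, h, r⟩
      (contents (List.replicate m true ++ false :: T).tail R N M X Y Z) ⟨some false, b, c, h, r⟩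
      (contents T (List.replicate m true ++ R) N M X (Y.drop m) ((Y.take m).reverse ++ Z))
      (5 * m + 1) := by
  induction m generalizing R Y Z with
  | zero => exact Runs.loop_false _ _ rfl
  | succ m ih =>
    obtain _ | ⟨y, Y⟩ := Y
    · simp at hm
    refine (Runs.loop_true (t := 4) rfl
      (Runs.push_seq (Runs.pop_seq (Runs.push_seq (Runs.pop _ _ _ _)))) ?_).mono
      (t := 4 + (5 * m + 1) + 1) (by omega)
    simp only [update_passed, contents_passed, update_table, contents_table, List.replicate_succ,
      List.cons_append, List.tail_cons, update_next, contents_next, update_shift, contents_shift,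
      List.head?_cons, Option.getD_some]
    refine (ih (true :: R) Y (y :: Z) (by simpa using hm)).of_eq rfl ?_ le_rfl
    rw [List.append_cons, ← List.replicate_succ', List.replicate_succ, List.cons_append]
    simp

theorem runs_mark (m : ℕ) (s b c h : Option Bool) (r : Bool) (T R N M X Y : List Bool)
    (hm : m < Y.length) :
    mark.Runs ⟨s, b, c, h, r⟩ (contents (block m ++ T) R N M X Y []) ⟨none, b, c, h, r⟩
      (contents T ((block m).reverse ++ R) N M X (Y.set m true) []) (8 * m + 7) := by
  rw [block_append, reverse_block_append]
  refine Runs.pop_seq ?_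
  simp only [update_table, contents_table]
  refine Runs.seq_le (runs_markLoop m b c h r T R N M X Y [] hm.le) (t' := 3 * m + 2 + 1 + 1 + 1)
    (Runs.push_seq (Runs.pop_seq (Runs.push_seq ?_))) (by omega)
  simp only [update_passed, contents_passed, update_next, contents_next]
  refine (runs_move (by decide) _ _).of_eq rfl ?_ ?_
  · simp [List.set_eq_take_append_cons_drop, hm]
  · simp

/-- Pass over the blocks of the letters `js` in the row of a state; if the state is in the current
set, mark the block of the letter `i`. -/
def row {k : ℕ} (i : Fin k) : List (Fin k) → Program
  | [] => .load id
  | j :: js => .seq (if j = i then .ite (fun v => v.bit == some true) mark skip else skip) (row i js)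

/-- The comparison `j = i` is settled when the program is built; only the bit of the state is tested
at run time. Marking preserves the length of `Y`, so the single bound `B` serves for all blocks. -/
theorem runs_row {k B : ℕ} (i : Fin k) (js : List (Fin k)) (f : Fin k → ℕ) (b : Bool)
    (c h : Option Bool) (r : Bool) (T R N M X Y : List Bool) (hf : ∀ j, f j < Y.length)
    (hB : Y.length ≤ B) :
    (row i js).Runs ⟨none, some b, c, h, r⟩
      (contents (js.flatMap (fun j => block (f j)) ++ T) R N M X Y []) ⟨none, some b, c, h, r⟩
      (contents T ((js.flatMap fun j => block (f j)).reverse ++ R) N M X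
        (if b = true ∧ i ∈ js then Y.set (f i) true else Y) []) (js.length * (8 * B + 8) + 1) := by
  induction js generalizing R Y with
  | nil => exact (Runs.load _ _ _).of_eq rfl (by simp) (by simp)
  | cons j js ih =>
    have hBj : f j ≤ B := (hf j).le.trans hB
    have hfirst : (if j = i then .ite (fun v => v.bit == some true) mark skip else skip : Program).Runs
        ⟨none, some b, c, h, r⟩
        (contents (block (f j) ++ (js.flatMap (fun j => block (f j)) ++ T)) R N M X Y [])
        ⟨none, some b, c, h, r⟩
        (contents (js.flatMap (fun j => block (f j)) ++ T) ((block (f j)).reverse ++ R) N M X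
          (if b = true ∧ j = i then Y.set (f i) true else Y) []) (8 * B + 8) := by
      by_cases hj : j = i
      · subst hj
        cases b
        · simp only [if_true]
          refine (Runs.ite_false _ (by simp) (runs_skip ..)).of_eq rfl (by simp) (by omega)
        · simp only [if_true]
          refine (Runs.ite_true _ (by simp) (runs_mark _ _ _ _ _ _ _ _ _ _ _ _ (hf j))).of_eq rfl
            (by simp) (by omega)
      · simp only [if_neg hj]
        exact (runs_skip ..).of_eq rfl (by simp [hj]) (by omega)
    simp only [List.flatMap_cons, List.append_assoc]
    refine hfirst.seq_le (ih _ _ ?_ ?_ |>.of_eq rfl ?_ le_rfl) ?_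
    · intro j'; split_ifs <;> simpa using hf j'
    · split_ifs <;> simpa using hB
    · simp only [List.reverse_append, List.append_assoc]
      congr 1
      cases b
      · simp
      · by_cases hj : j = i
        · subst hj; by_cases hm : j ∈ js <;> simp [hm]
        · have hj' : ¬ i = j := fun h => hj h.symm
          simp [hj, hj']
    · simp only [List.length_cons]; ring_nf; omega

/-- The loop of `scan`. -/
def scanLoop {k : ℕ} (i : Fin k) : Program :=
  .loop (fun v => v.bit.isSome)
    (.seq (row i (List.finRange k)) (.pop .image fun v s => { v with bit := s }))

/-- Pass over the transition table and mark the images of the states in the current set under the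
letter `i`. -/
def scan {k : ℕ} (i : Fin k) : Program :=
  .seq (.pop .image fun v s => { v with bit := s }) (scanLoop i)

/-- The encoding of the rows of a transition table. -/
def rows {k n : ℕ} (f : Fin n → Fin k → Fin n) (qs : List (Fin n)) : List Bool :=
  qs.flatMap fun q => (List.finRange k).flatMap fun j => block (f q j)

/-- The bits on `image` and the rows of the table are consumed in step: the bit of a state is in
memory while its row is read. -/
theorem runs_scanLoop {k n : ℕ} (i : Fin k) (f : Fin n → Fin k → Fin n) (x : Fin n → Bool)
    (qs : List (Fin n)) (c h : Option Bool) (r : Bool) (T R N M Y : List Bool)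
    (hY : Y.length = n) :
    (scanLoop i).Runs ⟨none, (qs.map x).head?, c, h, r⟩
      (contents (rows f qs ++ T) R N M (qs.map x).tail Y []) ⟨none, none, c, h, r⟩
      (contents T ((rows f qs).reverse ++ R) N M []
        (qs.foldl (fun Y q => if x q then Y.set (f q i) true else Y) Y) [])
      (qs.length * (k * (8 * n + 8) + 3) + 1) := by
  induction qs generalizing R Y with
  | nil => exact (Runs.loop_false _ _ rfl).of_eq rfl (by simp [rows]) (by simp)
  | cons q qs ih =>
    have hrow := runs_row i (List.finRange k) (fun j => (f q j : ℕ)) (x q) c h r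
      (rows f qs ++ T) R N M (qs.map x) Y (fun j => hY ▸ (f q j).2) hY.le
    simp only [List.mem_finRange, and_true, List.length_finRange] at hrow
    have hrows : rows f (q :: qs) ++ T =
        ((List.finRange k).flatMap fun j => block (f q j)) ++ (rows f qs ++ T) := by
      simp [rows]
    simp only [hrows, List.map_cons, List.head?_cons, List.tail_cons, List.foldl_cons]
    have hY' : (if x q = true then Y.set (f q i) true else Y).length = n := by
      split_ifs <;> simpa using hY
    refine (Runs.loop_true rfl (hrow.seq (Runs.pop _ _ _ _)) ?_).mono
      (t := k * (8 * n + 8) + 1 + 1 + (qs.length * (k * (8 * n + 8) + 3) + 1) + 1) ?_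
    · simp only [update_image, contents_image]
      refine (ih _ _ hY').of_eq rfl ?_ le_rfl
      simp [rows]
    · simp only [List.length_cons]; ring_nf; omega

theorem runs_scan {k n : ℕ} (i : Fin k) (f : Fin n → Fin k → Fin n) (x : Fin n → Bool)
    (qs : List (Fin n)) (c h : Option Bool) (r : Bool) (T R N M Y : List Bool)
    (hY : Y.length = n) :
    (scan i).Runs ⟨none, none, c, h, r⟩ (contents (rows f qs ++ T) R N M (qs.map x) Y [])
      ⟨none, none, c, h, r⟩
      (contents T ((rows f qs).reverse ++ R) N M []
        (qs.foldl (fun Y q => if x q then Y.set (f q i) true else Y) Y) [])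
      (qs.length * (k * (8 * n + 8) + 3) + 2) := by
  refine Runs.pop_seq ?_
  simp only [update_image, contents_image]
  exact runs_scanLoop i f x qs c h r T R N M Y hY

/-- The loop of `flush`. -/
def flushLoop : Program :=
  .loop (fun v => v.sym.isSome) (.seq (.push .image fun v => v.sym.getD false)
    (.seq (.push .next fun _ => false) (getSym .shift)))

/-- Make the next set the current one. -/
def flush : Program :=
  .seq (move .next .shift) (.seq (getSym .shift) flushLoop)

theorem runs_flushLoop (b c h : Option Bool) (r : Bool) (T R N M X Y Z : List Bool) :
    flushLoop.Runs ⟨Z.head?, b, c, h, r⟩ (contents T R N M X Y Z.tail) ⟨none, b, c, h, r⟩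
      (contents T R N M (Z.reverse ++ X) (List.replicate Z.length false ++ Y) [])
      (4 * Z.length + 1) := by
  induction Z generalizing X Y with
  | nil => exact Runs.loop_false _ _ rfl
  | cons z Z ih =>
    refine (Runs.loop_true (t := 3) rfl (Runs.push_seq (Runs.push_seq (Runs.pop _ _ _ _))) ?_).mono
      (t := 3 + (4 * Z.length + 1) + 1) (by simp only [List.length_cons]; omega)
    simp only [update_image, contents_image, update_next, contents_next, update_shift, contents_shift,
      List.head?_cons, List.tail_cons, Option.getD_some]
    refine (ih _ _).of_eq rfl ?_ le_rfl
    rw [List.append_cons _ false Y, ← List.replicate_succ']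
    simp

/-- Two reversals, from `next` to `shift` and from there to `image`, restore the order of the bits;
the second one also refills `next` with zeros. -/
theorem runs_flush (s b c h : Option Bool) (r : Bool) (T R N M Y : List Bool) :
    flush.Runs ⟨s, b, c, h, r⟩ (contents T R N M [] Y []) ⟨none, b, c, h, r⟩
      (contents T R N M Y (List.replicate Y.length false) []) (7 * Y.length + 4) := by
  have h1 := runs_move (a := .next) (b := .shift) (by decide) ⟨s, b, c, h, r⟩
    (contents T R N M [] Y [])
  simp only [update_next, contents_next, update_shift, contents_shift, List.append_nil] at h1
  refine h1.seq_le (t' := 4 * Y.length + 1 + 1) (Runs.pop_seq ?_) (by omega)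
  simp only [update_shift, contents_shift]
  refine (runs_flushLoop b c h r T R N M [] [] Y.reverse).of_eq rfl ?_ ?_
  · simp
  · simp

/-- Apply the letter `i` to the current set. -/
def letter {k : ℕ} (i : Fin k) : Program :=
  .seq (scan i) (.seq (move .passed .table) flush)

/-- The image of a set of states under the letter `i`. -/
def imageSet {k n : ℕ} (f : Fin n → Fin k → Fin n) (i : Fin k) (x : Fin n → Bool) : Fin n → Bool :=
  fun p => decide (∃ q, x q = true ∧ f q i = p)

theorem foldl_set {k n : ℕ} (f : Fin n → Fin k → Fin n) (i : Fin k) (x y : Fin n → Bool)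
    (qs : List (Fin n)) :
    qs.foldl (fun Y q => if x q then Y.set (f q i) true else Y) ((List.finRange n).map y) =
      (List.finRange n).map fun p => y p || decide (∃ q ∈ qs, x q = true ∧ f q i = p) := by
  induction qs generalizing y with
  | nil => simp
  | cons q qs ih =>
    have : (if x q then ((List.finRange n).map y).set (f q i) true else (List.finRange n).map y) =
        (List.finRange n).map fun p => y p || decide (x q = true ∧ f q i = p) := by
      cases hx : x q
      · simp
      · refine List.ext_getElem (by simp) fun m h1 h2 => ?_
        simp only [if_true, List.getElem_set, List.getElem_map, List.getElem_finRange, true_and]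
        by_cases hm : (f q i : ℕ) = m
        · simp [hm, Fin.ext_iff]
        · simp [hm, Fin.ext_iff]
    rw [List.foldl_cons, this, ih]
    simp [Bool.or_assoc]

theorem length_rows_le {k n : ℕ} (f : Fin n → Fin k → Fin n) (qs : List (Fin n)) :
    (rows f qs).length ≤ qs.length * (k * n) := by
  have hrow : ∀ (q : Fin n) (js : List (Fin k)),
      (js.flatMap fun j => block (f q j)).length ≤ js.length * n := by
    intro q js
    induction js with
    | nil => simp
    | cons j js ih =>
      rw [List.flatMap_cons, List.length_append, length_block, List.length_cons, Nat.succ_mul]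
      have := (f q j).2
      omega
  induction qs with
  | nil => simp [rows]
  | cons q qs ih =>
    have h1 := hrow q (List.finRange k)
    rw [List.length_finRange] at h1
    have h2 : rows f (q :: qs) = ((List.finRange k).flatMap fun j => block (f q j)) ++ rows f qs :=
      List.flatMap_cons ..
    rw [h2, List.length_append, List.length_cons, Nat.succ_mul]
    omega

/-- Table and `next` end as they began, which allows letters to be applied repeatedly. -/
theorem runs_letter {k n : ℕ} (i : Fin k) (f : Fin n → Fin k → Fin n) (x : Fin n → Bool)
    (c h : Option Bool) (r : Bool) (N M : List Bool) :
    (letter i).Runs ⟨none, none, c, h, r⟩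
      (contents (rows f (List.finRange n)) [] N M ((List.finRange n).map x)
        (List.replicate n false) [])
      ⟨none, none, c, h, r⟩
      (contents (rows f (List.finRange n)) [] N M ((List.finRange n).map (imageSet f i x))
        (List.replicate n false) []) (20 * (k + 1) * (n + 1) ^ 2) := by
  have h1 := runs_scan i f x (List.finRange n) c h r [] [] N M (List.replicate n false) (by simp)
  have hfold : (List.finRange n).foldl (fun Y q => if x q then Y.set (f q i) true else Y)
      (List.replicate n false) = (List.finRange n).map (imageSet f i x) := by
    have := foldl_set f i x (fun _ => false) (List.finRange n)
    rw [List.map_const', List.length_finRange] at this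
    rw [this]
    simp [imageSet]
  rw [hfold, List.append_nil, List.append_nil, List.length_finRange] at h1
  have h2 := runs_move (a := .passed) (b := .table) (by decide) ⟨none, none, c, h, r⟩
    (contents [] (rows f (List.finRange n)).reverse N M [] ((List.finRange n).map (imageSet f i x)) [])
  simp only [update_passed, contents_passed, update_table, contents_table, List.append_nil,
    List.reverse_reverse, List.length_reverse] at h2
  have h3 := runs_flush none none c h r (rows f (List.finRange n)) [] N M
    ((List.finRange n).map (imageSet f i x))
  rw [List.length_map, List.length_finRange] at h3
  -- The scan takes `8kn(n+1) + 3n + 2` steps, the return of the table at most `3kn² + 2`, and the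
  -- flush `7n + 4`.
  refine (h1.seq (h2.seq h3)).mono ?_
  have := length_rows_le f (List.finRange n)
  rw [List.length_finRange] at this
  nlinarith [Nat.zero_le (k * n), Nat.zero_le (k * n * n), Nat.zero_le k, Nat.zero_le n]

/-! ### Counting loops and patterns -/

/-- The loop of `forSize`. -/
def forSizeLoop (p : Program) : Program :=
  .loop (fun v => v.ctr.isSome) (.seq (.push .counted fun _ => true)
    (.seq p (.pop .size fun v s => { v with ctr := s })))

/-- Repeat a program as often as there are states. -/
def forSize (p : Program) : Program :=
  .seq (.pop .size fun v s => { v with ctr := s })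
    (.seq (forSizeLoop p) (move .counted .size))

/-- `X j` is the content of `image` after `j` rounds. The hypothesis on the body covers all `N` and
`M` because the two counter stacks change from round to round. -/
theorem runs_forSizeLoop {p : Program} {h : Option Bool} {r : Bool} {T Y : List Bool} {t : ℕ}
    (X : ℕ → List Bool)
    (hp : ∀ j N M, p.Runs ⟨none, none, some true, h, r⟩ (contents T [] N M (X j) Y [])
      ⟨none, none, some true, h, r⟩ (contents T [] N M (X (j + 1)) Y []) t)
    (m j : ℕ) (M : List Bool) :
    (forSizeLoop p).Runs ⟨none, none, (List.replicate m true).head?, h, r⟩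
      (contents T [] (List.replicate m true).tail M (X j) Y []) ⟨none, none, none, h, r⟩
      (contents T [] [] (List.replicate m true ++ M) (X (j + m)) Y []) (m * (t + 3) + 1) := by
  induction m generalizing j M with
  | zero => exact (Runs.loop_false _ _ rfl).mono (by simp)
  | succ m ih =>
    have hbody := (hp j (List.replicate m true) (true :: M)).seq
      (Runs.pop .size (fun v s => { v with ctr := s }) _ _)
    rw [← update_counted _ _ _ M] at hbody
    refine (Runs.loop_true (t := t + 1 + 1) rfl (Runs.push_seq hbody) ?_).mono
      (t := t + 1 + 1 + (m * (t + 3) + 1) + 1) (by ring_nf; omega)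
    simp only [update_size, contents_size, List.replicate_succ]
    refine (ih (j + 1) (true :: M)).of_eq rfl ?_ le_rfl
    rw [List.append_cons, ← List.replicate_succ', List.replicate_succ, add_right_comm, add_assoc]

theorem runs_forSize {p : Program} {h : Option Bool} {r : Bool} {T Y : List Bool} {t : ℕ}
    (X : ℕ → List Bool)
    (hp : ∀ j N M, p.Runs ⟨none, none, some true, h, r⟩ (contents T [] N M (X j) Y [])
      ⟨none, none, some true, h, r⟩ (contents T [] N M (X (j + 1)) Y []) t) (n : ℕ) :
    (forSize p).Runs ⟨none, none, none, h, r⟩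
      (contents T [] (List.replicate n true) [] (X 0) Y []) ⟨none, none, none, h, r⟩
      (contents T [] (List.replicate n true) [] (X n) Y []) (n * (t + 6) + 4) := by
  have h1 := runs_forSizeLoop X hp n 0 []
  refine Runs.mono (t := (n * (t + 3) + 1 + (3 * n + 2)) + 1) (Runs.pop_seq ?_)
    (by ring_nf; omega)
  simp only [update_size, contents_size]
  refine h1.seq_le ((runs_move (by decide) _ _).of_eq rfl ?_ le_rfl) ?_
  · simp
  · simp

/-- Apply the word described by a pattern to the current set. -/
def pattern {k : ℕ} : List (Fin k × Bool) → Program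
  | [] => .load id
  | x :: P => .seq (if x.2 then forSize (letter x.1) else letter x.1) (pattern P)

/-- The image of a set of states under the word described by a pattern. -/
def patternSet {k n : ℕ} (f : Fin n → Fin k → Fin n) (P : List (Fin k × Bool))
    (x : Fin n → Bool) : Fin n → Bool :=
  P.foldl (fun x y => (imageSet f y.1)^[if y.2 then n else 1] x) x

theorem runs_pattern {k n : ℕ} (P : List (Fin k × Bool)) (f : Fin n → Fin k → Fin n)
    (x : Fin n → Bool) (h : Option Bool) (r : Bool) :
    (pattern P).Runs ⟨none, none, none, h, r⟩
      (contents (rows f (List.finRange n)) [] (List.replicate n true) [] ((List.finRange n).map x)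
        (List.replicate n false) [])
      ⟨none, none, none, h, r⟩
      (contents (rows f (List.finRange n)) [] (List.replicate n true) []
        ((List.finRange n).map (patternSet f P x)) (List.replicate n false) [])
      (P.length * (30 * (k + 1) * (n + 1) ^ 3) + 1) := by
  induction P generalizing x with
  | nil => exact (Runs.load _ _ _).of_eq rfl rfl (by simp)
  | cons y P ih =>
    refine Runs.seq_le (t := 30 * (k + 1) * (n + 1) ^ 3) ?_
      (ih ((imageSet f y.1)^[if y.2 then n else 1] x))
      (le_of_eq (by rw [List.length_cons]; ring))
    obtain ⟨i, b⟩ := y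
    cases b
    · refine (runs_letter i f x none h r _ _).mono ?_
      have : (n + 1) ^ 2 ≤ (n + 1) ^ 3 := Nat.pow_le_pow_right (by omega) (by omega)
      nlinarith [Nat.zero_le ((k + 1) * (n + 1) ^ 3)]
    · refine (runs_forSize (fun j => (List.finRange n).map ((imageSet f i)^[j] x)) (fun j N M => ?_)
        n).mono (?_ : n * (20 * (k + 1) * (n + 1) ^ 2 + 6) + 4 ≤ _)
      · rw [Function.iterate_succ_apply']
        exact runs_letter i f _ _ _ _ _ _
      · have h1 : n + 1 ≤ (n + 1) ^ 3 := Nat.le_self_pow (by omega) _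
        have h2 : n * (20 * (k + 1) * (n + 1) ^ 2) ≤ 20 * (k + 1) * (n + 1) ^ 3 := by
          calc n * (20 * (k + 1) * (n + 1) ^ 2) ≤ (n + 1) * (20 * (k + 1) * (n + 1) ^ 2) :=
                Nat.mul_le_mul_right _ (by omega)
            _ = _ := by ring
        nlinarith [Nat.zero_le (k * (n + 1) ^ 3)]

/-! ### Testing the patterns -/

/-- The representation of the number of states found. -/
def hitCount (m : ℕ) : Option Bool :=
  if m = 0 then none else some (decide (m = 1))

/-- The loop of `check`. -/
def checkLoop : Program :=
  .loop (fun v => v.sym.isSome) (.seq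
    (.load fun v => { v with hits := if v.sym = some true then some v.hits.isNone else v.hits })
    (getSym .image))

/-- Remove the current set, and answer `true` if it had exactly one element. -/
def check : Program :=
  .seq (getSym .image) (.seq checkLoop
    (.load fun v => { v with hits := none, answer := v.answer || v.hits == some true }))

/-- The count is needed only as zero, one or more. Replacing `hits` by `some hits.isNone` is the
successor on these three values. -/
theorem runs_checkLoop (m : ℕ) (b c : Option Bool) (r : Bool) (T R N M X Y Z : List Bool) :
    checkLoop.Runs ⟨X.head?, b, c, hitCount m, r⟩ (contents T R N M X.tail Y Z)
      ⟨none, b, c, hitCount (m + X.count true), r⟩ (contents T R N M [] Y Z)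
      (3 * X.length + 1) := by
  induction X generalizing m with
  | nil => exact Runs.loop_false _ _ rfl
  | cons x X ih =>
    refine (Runs.loop_true (t := 2) rfl (Runs.load_seq (Runs.pop _ _ _ _)) ?_).mono
      (t := 2 + (3 * X.length + 1) + 1) (by simp only [List.length_cons]; omega)
    simp only [update_image, contents_image, List.head?_cons, List.tail_cons]
    cases x
    · exact (ih m).of_eq (by simp) rfl le_rfl
    · have h1 : some (hitCount m).isNone = hitCount (m + 1) := by
        by_cases hm : m = 0 <;> simp [hitCount, hm]
      have h2 := ih (m + 1)
      rw [← h1] at h2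
      exact h2.of_eq (by simp [add_assoc, add_comm 1]) rfl le_rfl

theorem runs_check (s b c : Option Bool) (r : Bool) (T R N M X Y Z : List Bool) :
    check.Runs ⟨s, b, c, none, r⟩ (contents T R N M X Y Z)
      ⟨none, b, c, none, r || decide (X.count true = 1)⟩ (contents T R N M [] Y Z)
      (3 * X.length + 3) := by
  have h1 := runs_checkLoop 0 b c r T R N M X Y Z
  refine Runs.pop_seq ?_
  simp only [update_image, contents_image]
  refine h1.seq_le ((Runs.load _ _ _).of_eq ?_ rfl le_rfl) le_rfl
  have : (hitCount (0 + X.count true) == some true) = decide (X.count true = 1) := by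
    by_cases hX : X.count true = 0
    · simp [hitCount, hX]
    · by_cases hX' : X.count true = 1 <;> simp [hitCount, hX, hX']
  simp only [this]

/-- Test for every pattern of a list whether it describes a synchronizing word. -/
def trials {k : ℕ} : List (List (Fin k × Bool)) → Program
  | [] => .load id
  | P :: Ps => .seq (.seq (forSize (.push .image fun _ => true)) (.seq (pattern P) check)) (trials Ps)

/-- A factor for the time bound of `trials`. -/
def trialsTime {k : ℕ} : List (List (Fin k × Bool)) → ℕ
  | [] => 1
  | P :: Ps => P.length * (30 * (k + 1)) + 20 + trialsTime Ps

/-- Whether the word described by a pattern takes all states to one state. -/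
def patternSyncs {k n : ℕ} (f : Fin n → Fin k → Fin n) (P : List (Fin k × Bool)) : Bool :=
  decide (((List.finRange n).map (patternSet f P fun _ => true)).count true = 1)

theorem runs_trials {k n : ℕ} (Ps : List (List (Fin k × Bool))) (f : Fin n → Fin k → Fin n)
    (r : Bool) :
    (trials Ps).Runs ⟨none, none, none, none, r⟩
      (contents (rows f (List.finRange n)) [] (List.replicate n true) [] []
        (List.replicate n false) [])
      ⟨none, none, none, none, r || Ps.any (patternSyncs f)⟩
      (contents (rows f (List.finRange n)) [] (List.replicate n true) [] []
        (List.replicate n false) []) (trialsTime Ps * (n + 1) ^ 3) := by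
  induction Ps generalizing r with
  | nil =>
    refine (Runs.load _ _ _).of_eq (by simp) rfl ?_
    rw [trialsTime, one_mul]
    exact Nat.one_le_pow _ _ (by omega)
  | cons P Ps ih =>
    -- Pushing `true` once per state makes the full set the current one.
    have h1 := runs_forSize (p := .push .image fun _ => true) (h := none) (r := r)
      (T := rows f (List.finRange n)) (Y := List.replicate n false)
      (fun j => List.replicate j true) (t := 1)
      (fun j N M => (Runs.push _ _ _ _).of_eq rfl (by simp [List.replicate_succ]) le_rfl) n
    have hX : List.replicate n true = (List.finRange n).map fun _ => true := by
      rw [List.map_const', List.length_finRange]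
    have h2 := runs_pattern P f (fun _ => true) none r
    rw [← hX] at h2
    have h3 := runs_check none none none r (rows f (List.finRange n)) [] (List.replicate n true) []
      ((List.finRange n).map (patternSet f P fun _ => true)) (List.replicate n false) []
    rw [List.length_map, List.length_finRange] at h3
    refine ((h1.seq (h2.seq h3)).seq (ih _)).of_eq ?_ rfl ?_
    · simp [patternSyncs, Bool.or_assoc]
    · rw [trialsTime]
      have : n + 1 ≤ (n + 1) ^ 3 := Nat.le_self_pow (by omega) _
      nlinarith

/-! ### Reading the input and cleaning up -/

/-- The loop of `setup`. -/
def setupLoop : Program :=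
  .loop (fun v => v.sym == some true) (.seq (.push .size fun _ => true)
    (.seq (.push .next fun _ => false) (getSym .table)))

/-- Read the number of states, and initialize the next set as the empty set. -/
def setup : Program :=
  .seq (getSym .table) (.seq setupLoop (.load fun v => { v with sym := none }))

theorem runs_setupLoop (m : ℕ) (b c h : Option Bool) (r : Bool) (T R N M X Y Z : List Bool) :
    setupLoop.Runs ⟨(List.replicate m true ++ false :: T).head?, b, c, h, r⟩
      (contents (List.replicate m true ++ false :: T).tail R N M X Y Z) ⟨some false, b, c, h, r⟩
      (contents T R (List.replicate m true ++ N) M X (List.replicate m false ++ Y) Z)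
      (4 * m + 1) := by
  induction m generalizing N Y with
  | zero => exact Runs.loop_false _ _ rfl
  | succ m ih =>
    refine (Runs.loop_true (t := 3) rfl (Runs.push_seq (Runs.push_seq (Runs.pop _ _ _ _))) ?_).mono
      (t := 3 + (4 * m + 1) + 1) (by omega)
    simp only [update_size, contents_size, update_table, contents_table, List.replicate_succ,
      List.cons_append, List.tail_cons, update_next, contents_next]
    refine (ih (true :: N) (false :: Y)).of_eq rfl ?_ le_rfl
    simp only [List.append_cons _ _ N, List.append_cons _ _ Y, ← List.replicate_succ',
      List.replicate_succ, List.cons_append]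

theorem runs_setup (n : ℕ) (T : List Bool) :
    setup.Runs ⟨none, none, none, none, false⟩ (contents (block n ++ T) [] [] [] [] [] [])
      ⟨none, none, none, none, false⟩
      (contents T [] (List.replicate n true) [] [] (List.replicate n false) []) (4 * n + 3) := by
  rw [block_append]
  refine Runs.pop_seq ?_
  simp only [update_table, contents_table]
  refine (runs_setupLoop n none none none false T [] [] [] [] [] []).seq_le
    ((Runs.load _ _ _).of_eq rfl ?_ le_rfl) le_rfl
  simp

/-- Empty a stack. -/
def clear (k : Stack) : Program :=
  .seq (getSym k) (.loop (fun v => v.sym.isSome) (getSym k))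

theorem runs_clear (k : Stack) (v : Memory) (S : Stack → List Bool) :
    (clear k).Runs v S { v with sym := none } (Function.update S k []) (2 * (S k).length + 2) := by
  have hloop : ∀ (l : List Bool) (v : Memory) (S : Stack → List Bool), S k = l.tail →
      v.sym = l.head? → (StackProgram.loop (fun v => v.sym.isSome) (getSym k)).Runs v S
        { v with sym := none } (Function.update S k []) (2 * l.length + 1) := by
    intro l
    induction l with
    | nil =>
      intro v S hS hv
      refine (Runs.loop_false _ S (by simp [hv])).of_eq ?_ ?_ (by simp)
      · cases v; simp_all
      · rw [eq_comm, Function.update_eq_self_iff]; simpa using hS.symm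
    | cons c l ih =>
      intro v S hS hv
      refine (Runs.loop_true (by simp [hv]) (Runs.pop _ _ _ _) (ih _ _ ?_ ?_)).of_eq rfl ?_ ?_
      · simp [hS]
      · simp [hS]
      · simp
      · simp only [List.length_cons]; omega
  refine Runs.pop_seq ((hloop (S k) _ _ ?_ ?_).of_eq rfl ?_ le_rfl)
  · simp
  · simp
  · simp

/-- Empty the stacks, except for the answer. -/
def finish : Program :=
  .seq (clear .table) (.seq (clear .size) (.seq (clear .next)
    (.seq (.push .table fun v => v.answer) (.load fun v => { v with answer := false }))))

theorem runs_finish (r : Bool) (T N Y : List Bool) :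
    finish.Runs ⟨none, none, none, none, r⟩ (contents T [] N [] [] Y [])
      ⟨none, none, none, none, false⟩ (contents [r] [] [] [] [] [] [])
      (2 * T.length + 2 * N.length + 2 * Y.length + 8) := by
  have h1 := runs_clear .table ⟨none, none, none, none, r⟩ (contents T [] N [] [] Y [])
  have h2 := runs_clear .size ⟨none, none, none, none, r⟩ (contents [] [] N [] [] Y [])
  have h3 := runs_clear .next ⟨none, none, none, none, r⟩ (contents [] [] [] [] [] Y [])
  simp only [update_table, update_size, update_next, contents_table, contents_size, contents_next]
    at h1 h2 h3
  refine (h1.seq (h2.seq (h3.seq (Runs.push_seq ((Runs.load _ _ _).of_eq rfl ?_ le_rfl))))).mono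
    (by omega)
  simp

/-- The program that tests a list of patterns. -/
def main {k : ℕ} (Ps : List (List (Fin k × Bool))) : Program :=
  .seq setup (.seq (trials Ps) finish)

theorem runs_main {k n : ℕ} (Ps : List (List (Fin k × Bool))) (f : Fin n → Fin k → Fin n) :
    (main Ps).Runs ⟨none, none, none, none, false⟩
      (Function.update (fun _ => []) .table (block n ++ rows f (List.finRange n)))
      ⟨none, none, none, none, false⟩
      (Function.update (fun _ => []) .table [Ps.any (patternSyncs f)])
      ((trialsTime Ps + 2 * k + 20) * (n + 1) ^ 3) := by
  have hupd : ∀ l : List Bool,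
      Function.update (fun _ => []) Stack.table l = contents l [] [] [] [] [] [] := by
    intro l; funext j; cases j <;> rfl
  rw [hupd, hupd]
  refine ((runs_setup n _).seq ((runs_trials Ps f false).seq (runs_finish _ _ _ _))).of_eq rfl
    (by simp) ?_
  have h1 := length_rows_le f (List.finRange n)
  rw [List.length_finRange] at h1
  have h2 : n + 1 ≤ (n + 1) ^ 3 := Nat.le_self_pow (by omega) _
  have h3 : n * (k * n) ≤ k * (n + 1) ^ 3 := by
    calc n * (k * n) = k * n ^ 2 := by ring
      _ ≤ k * (n + 1) ^ 3 := Nat.mul_le_mul_left _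
        ((Nat.pow_le_pow_left (by omega) 2).trans (Nat.pow_le_pow_right (by omega) (by omega)))
  simp only [List.length_replicate]
  nlinarith

end SyncMachine

/-! ### Synchronizing words of commutative semi-automata -/

namespace SemiAutomaton

variable {α Q : Type*}

theorem run_append (A : SemiAutomaton α Q) (q : Q) (u v : List α) :
    A.run q (u ++ v) = A.run (A.run q u) v :=
  List.foldl_append

theorem run_perm {A : SemiAutomaton α Q} (hA : A.IsCommutative) {u v : List α} (h : u.Perm v)
    (q : Q) : A.run q u = A.run q v :=
  haveI : RightCommutative A.step := ⟨hA⟩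
  h.foldl_eq q

/-- Without states the range is empty and has cardinality 0, hence the condition `Nonempty Q`. -/
theorem isSyncWord_iff {A : SemiAutomaton α Q} {w : List α} :
    A.IsSyncWord w ↔ Nonempty Q ∧ ∃ s, ∀ q, A.run q w = s := by
  unfold IsSyncWord
  rw [Set.ncard_eq_one]
  constructor
  · rintro ⟨s, hs⟩
    refine ⟨?_, s, fun q => ?_⟩
    · rw [← Set.range_nonempty_iff_nonempty (f := fun q => A.run q w), hs]
      exact Set.singleton_nonempty s
    · have : A.run q w ∈ Set.range fun q => A.run q w := ⟨q, rfl⟩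
      rwa [hs] at this
  · rintro ⟨_, s, hs⟩
    exact ⟨s, by simp [hs]⟩

theorem IsSyncWord.of_perm {A : SemiAutomaton α Q} (hA : A.IsCommutative) {u v : List α}
    (hu : A.IsSyncWord u) (h : u.Perm v) : A.IsSyncWord v := by
  rw [isSyncWord_iff] at *
  simpa only [run_perm hA h] using hu

theorem exists_perm_append_of_subperm {u v : List α} (h : u.Subperm v) :
    ∃ l, v.Perm (u ++ l) := by
  obtain ⟨u', hu, hs⟩ := h
  obtain ⟨l, hl⟩ := hs.exists_perm_append
  exact ⟨l, hl.trans (hu.append_right l)⟩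

/-- By commutativity `u` may act first; the remaining letters then act on a single state. -/
theorem IsSyncWord.of_subperm {A : SemiAutomaton α Q} (hA : A.IsCommutative) {u v : List α}
    (hu : A.IsSyncWord u) (h : u.Subperm v) : A.IsSyncWord v := by
  obtain ⟨l, hl⟩ := exists_perm_append_of_subperm h
  refine IsSyncWord.of_perm hA ?_ hl.symm
  rw [isSyncWord_iff] at *
  obtain ⟨h0, s, hs⟩ := hu
  exact ⟨h0, A.run s l, fun q => by rw [run_append, hs]⟩

/-- A fixed point that is reached at all is reached within as many steps as there are points. -/
theorem iterate_card_eq_of_iterate_eq [Fintype Q] {f : Q → Q} {p s : Q} {m : ℕ} (hs : f s = s)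
    (h : f^[m] p = s) : f^[Fintype.card Q] p = s := by
  have hge : ∀ j, f^[j + m] p = s := fun j => by
    rw [Function.iterate_add_apply, h, Function.iterate_fixed hs]
  -- Two of the first `card Q + 1` iterates coincide, so the orbit is periodic from index `i` on,
  -- with period `j - i`.
  obtain ⟨i, j, hij, he⟩ := Fintype.exists_ne_map_eq_of_card_lt
    (fun i : Fin (Fintype.card Q + 1) => f^[i] p) (by simp)
  wlog hlt : i < j generalizing i j
  · exact this j i hij.symm he.symm (lt_of_le_of_ne (not_lt.mp hlt) hij.symm)
  have hlt' : (i : ℕ) < j := hlt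
  have hper : ∀ r, f^[r * (j - i) + i] p = f^[i] p := by
    intro r
    induction r with
    | zero => simp
    | succ r ih =>
      have : (r + 1) * ((j : ℕ) - i) + i = r * (j - i) + j := by
        rw [Nat.add_mul]; omega
      rw [this, Function.iterate_add_apply, ← he, ← Function.iterate_add_apply, ih]
  -- The `i`-th iterate recurs at an index beyond `m`, where the orbit is already constant.
  have hi : f^[i] p = s := by
    rw [← hper m]
    have : m ≤ m * ((j : ℕ) - i) := Nat.le_mul_of_pos_right _ (by omega)
    have h2 := hge (m * (j - i) + i - m)
    rwa [Nat.sub_add_cancel (by omega)] at h2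
  have : Fintype.card Q = (Fintype.card Q - i) + i := by omega
  rw [this, Function.iterate_add_apply, hi, Function.iterate_fixed hs]

theorem run_replicate (A : SemiAutomaton α Q) (q : Q) (a : α) (m : ℕ) :
    A.run q (List.replicate m a) = (fun q => A.step q a)^[m] q := by
  induction m generalizing q with
  | zero => rfl
  | succ m ih => exact ih (A.step q a)

variable [DecidableEq α]

/-- Rearrange `w` as `u` followed by `n + 1` copies of `a`. The common final state is fixed by `a`,
so from each state reached after `u` already `n` copies lead to it. -/
theorem IsSyncWord.erase [Fintype Q] {A : SemiAutomaton α Q} (hA : A.IsCommutative) {w : List α}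
    {a : α} (hw : A.IsSyncWord w) (ha : Fintype.card Q < w.count a) :
    A.IsSyncWord (w.erase a) := by
  set n := Fintype.card Q
  have hsub : (List.replicate n a).Subperm (w.erase a) := by
    refine List.Sublist.subperm (List.replicate_sublist_iff.mpr ?_)
    rw [List.count_erase_self]; omega
  obtain ⟨u, hu⟩ := exists_perm_append_of_subperm hsub
  have hu' : (w.erase a).Perm (u ++ List.replicate n a) := hu.trans List.perm_append_comm
  have hw' : w.Perm (u ++ List.replicate (n + 1) a) := by
    have hpos : 0 < w.count a := by omega
    refine (List.perm_cons_erase (List.count_pos_iff.mp hpos)).trans ?_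
    rw [List.replicate_succ]
    exact (hu'.cons a).trans List.perm_middle.symm
  refine IsSyncWord.of_perm hA ?_ hu'.symm
  have hw := hw.of_perm hA hw'
  rw [isSyncWord_iff] at hw ⊢
  obtain ⟨h0, s, hs⟩ := hw
  refine ⟨h0, s, fun q => ?_⟩
  -- Reading `a` before the word leads to `s`, reading it after the word leads to the `a`-successor
  -- of `s`; by commutativity the two agree.
  have hfix : A.step s a = s := by
    obtain ⟨q⟩ := h0
    have h1 := hs (A.step q a)
    have h2 : A.run (A.step q a) (u ++ List.replicate (n + 1) a) =
        A.run q ((u ++ List.replicate (n + 1) a) ++ [a]) :=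
      run_perm hA (u := a :: (u ++ List.replicate (n + 1) a)) (List.perm_append_singleton _ _).symm q
    rw [h2, run_append, hs] at h1
    exact h1
  have h3 := hs q
  rw [run_append, run_replicate] at h3 ⊢
  exact iterate_card_eq_of_iterate_eq (f := fun q => A.step q a) hfix h3

/-- Only the numbers of occurrences of the letters, up to the number of states, matter. -/
theorem IsSyncWord.of_count_le [Fintype Q] {A : SemiAutomaton α Q} (hA : A.IsCommutative)
    {w w' : List α} (hw : A.IsSyncWord w)
    (h : ∀ a, min (w.count a) (Fintype.card Q) ≤ w'.count a) : A.IsSyncWord w' := by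
  -- Letters occurring more than `card Q` times are erased one by one. Once no such letter is left,
  -- `w'` contains `w` up to order.
  induction hl : w.length using Nat.strong_induction_on generalizing w with
  | _ l ih =>
    by_cases hc : ∃ a, Fintype.card Q < w.count a
    · obtain ⟨a, ha⟩ := hc
      have hmem : a ∈ w := List.count_pos_iff.mp (by omega)
      refine ih (w.erase a).length ?_ (hw.erase hA ha) (fun b => ?_) rfl
      · rw [List.length_erase_of_mem hmem]
        have := List.length_pos_of_mem hmem
        omega
      · refine le_trans (min_le_min_right _ ?_) (h b)
        exact List.Sublist.count_le b List.erase_sublist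
    · push Not at hc
      refine hw.of_subperm hA (List.subperm_iff_count.mpr fun a => ?_)
      have := h a
      rwa [min_eq_left (hc a)] at this

end SemiAutomaton

/-! ### Dickson's lemma and the finitely many patterns -/

/-- Membership in a set of vectors of natural numbers that is closed downwards depends only on the
entries up to a constant. -/
theorem IsLowerSet.exists_truncation {ι : Type*} [Finite ι] {D : Set (ι → ℕ)} (hD : IsLowerSet D) :
    ∃ N : ℕ, ∀ c, (fun i => min (c i) N) ∈ D → c ∈ D := by
  by_contra! hcon
  choose c hc hcD using hcon
  -- Suppose every `N` has a counterexample `c N`. Dickson's lemma gives a monotone subsequence. A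
  -- late term, truncated at an index of at least the bound `B` of the first term, still dominates
  -- the first term, which is therefore in `D`.
  obtain ⟨g, hg⟩ := (wellQuasiOrdered_le (α := ι → ℕ)).exists_monotone_subseq c
  obtain ⟨B, hB⟩ := (Set.finite_range (c (g 0))).bddAbove
  have hgB : B ≤ g B := g.strictMono.le_apply
  refine hcD (g 0) (hD (fun i => ?_) (hc (g B)))
  have h1 : c (g 0) i ≤ B := hB ⟨i, rfl⟩
  have h2 := hg 0 B (Nat.zero_le B) i
  exact le_min h2 (h1.trans hgB)

/-- The word described by a pattern: an entry `(i, false)` stands for the `i`-th letter, an entry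
`(i, true)` for its `n`-th power. -/
def patternWord {α : Type*} {k : ℕ} (e : Fin k → α) (n : ℕ) (P : List (Fin k × Bool)) : List α :=
  P.flatMap fun x => List.replicate (if x.2 then n else 1) (e x.1)

theorem exists_pattern {α : Type*} [DecidableEq α] {k : ℕ} (e : Fin k ≃ α) (c : α → ℕ)
    (b : α → Prop) [DecidablePred b] :
    ∃ P : List (Fin k × Bool), ∀ n a,
      (patternWord e n P).count a = c a + if b a then n else 0 := by
  refine ⟨(List.finRange k).flatMap fun i => List.replicate (c (e i)) (i, false) ++
    if b (e i) then [(i, true)] else [], fun n a => ?_⟩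
  have hpow : ∀ (i : Fin k) (m : ℕ),
      (List.replicate m (i, false)).flatMap
        (fun x : Fin k × Bool => List.replicate (if x.2 then n else 1) (e x.1)) =
      List.replicate m (e i) := by
    intro i m
    induction m with
    | zero => rfl
    | succ m ih => rw [List.replicate_succ, List.flatMap_cons, ih]; rfl
  have hone : ∀ i, (patternWord e n (List.replicate (c (e i)) (i, false) ++
      if b (e i) then [(i, true)] else [])).count a =
      if i = e.symm a then c a + if b a then n else 0 else 0 := by
    intro i
    rw [patternWord, List.flatMap_append, hpow, List.count_append, List.count_replicate]
    by_cases hi : i = e.symm a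
    · subst hi
      by_cases hb : b a <;> simp [hb]
    · have hne : e i ≠ a := fun h => hi (by simp [← h])
      by_cases hb : b (e i) <;> simp [hb, hi, hne, List.count_replicate]
  simp only [patternWord] at hone ⊢
  -- Only the summand of the index `e.symm a` contributes occurrences of `a`.
  rw [List.flatMap_assoc, List.count_flatMap]
  simp only [Function.comp_def, hone]
  rw [← List.ofFn_eq_map, List.sum_ofFn, Finset.sum_ite_eq' Finset.univ (e.symm a),
    if_pos (Finset.mem_univ _)]

/-- For every language there are finitely many patterns such that a commutative semi-automaton has
a synchronizing word in the language if and only if one of the patterns describes one. -/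
theorem exists_patterns {α : Type*} {k : ℕ} (e : Fin k ≃ α) (L : Language α) :
    ∃ Ps : List (List (Fin k × Bool)), ∀ (n : ℕ) (A : SemiAutomaton α (Fin n)), A.IsCommutative →
      (A.HasSyncWordIn L ↔ ∃ P ∈ Ps, A.IsSyncWord (patternWord e n P)) := by
  classical
  have : Fintype α := Fintype.ofEquiv _ e
  -- The downward closure of the set of count vectors of `L`.
  set D : Set (α → ℕ) := {c | ∃ w ∈ L, ∀ a, c a ≤ w.count a} with hDdef
  have hD : IsLowerSet D := fun c c' hle ⟨w, hw, hc⟩ => ⟨w, hw, fun a => (hle a).trans (hc a)⟩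
  obtain ⟨N, hN⟩ := hD.exists_truncation
  -- An entry equal to `N` stands for arbitrarily many occurrences, so it receives the `n`-th power.
  choose P hP using fun m : α → ℕ => exists_pattern e m fun a => m a = N
  have hfin : {m : α → ℕ | m ∈ D ∧ ∀ a, m a ≤ N}.Finite :=
    (Set.finite_Iic (fun _ : α => N)).subset fun m hm => hm.2
  refine ⟨(hfin.toFinset.image P).toList, fun n A hA => ⟨?_, ?_⟩⟩
  · rintro ⟨w, hw, hs⟩
    refine ⟨P fun a => min (w.count a) N, ?_, hs.of_count_le hA fun a => ?_⟩
    · simp only [Finset.mem_toList, Finset.mem_image, Set.Finite.mem_toFinset]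
      exact ⟨_, ⟨⟨w, hw, fun a => min_le_left _ _⟩, fun a => min_le_right _ _⟩, rfl⟩
    -- Below `N` the pattern has exactly the count of `w`; from `N` on it has `N + n` copies, at
    -- least the `n` that matter.
    · rw [hP, Fintype.card_fin]
      split_ifs <;> omega
  · rintro ⟨_, hmem, hs⟩
    simp only [Finset.mem_toList, Finset.mem_image, Set.Finite.mem_toFinset] at hmem
    obtain ⟨m, ⟨hmD, hmN⟩, rfl⟩ := hmem
    have : (fun a => (patternWord e n (P m)).count a) ∈ D := by
      -- Truncating the counts of the pattern word at `N` gives back `m`, so some word of `L`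
      -- contains the pattern word up to order.
      refine hN _ (hD (fun a => ?_) hmD)
      have := hmN a
      simp only [hP]
      split_ifs <;> omega
    obtain ⟨w, hw, hle⟩ := this
    exact ⟨w, hw, hs.of_subperm hA (List.subperm_iff_count.mpr hle)⟩

/-! ### Correctness of the tests -/

namespace SyncMachine

variable {α : Type*} {k n : ℕ}

theorem iterate_imageSet (A : SemiAutomaton α (Fin n)) (e : Fin k → α) (i : Fin k) (m : ℕ)
    (x : Fin n → Bool) :
    (imageSet (fun q j => A.step q (e j)) i)^[m] x =
      fun p => decide (∃ q, x q = true ∧ A.run q (List.replicate m (e i)) = p) := by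
  induction m generalizing x with
  | zero =>
    funext p
    simp [SemiAutomaton.run]
  | succ m ih =>
    rw [Function.iterate_succ_apply, ih]
    funext p
    rw [decide_eq_decide]
    simp [imageSet, SemiAutomaton.run, List.replicate_succ]

theorem patternSet_eq (A : SemiAutomaton α (Fin n)) (e : Fin k → α) (P : List (Fin k × Bool))
    (x : Fin n → Bool) :
    patternSet (fun q j => A.step q (e j)) P x =
      fun p => decide (∃ q, x q = true ∧ A.run q (patternWord e n P) = p) := by
  induction P generalizing x with
  | nil =>
    funext p
    simp [patternSet, patternWord, SemiAutomaton.run]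
  | cons y P ih =>
    have hw : patternWord e n (y :: P) =
        List.replicate (if y.2 then n else 1) (e y.1) ++ patternWord e n P := List.flatMap_cons ..
    have hs : patternSet (fun q j => A.step q (e j)) (y :: P) x =
        patternSet (fun q j => A.step q (e j)) P
          ((imageSet (fun q j => A.step q (e j)) y.1)^[if y.2 then n else 1] x) := rfl
    rw [hs, iterate_imageSet, ih, hw]
    funext p
    simp [SemiAutomaton.run_append]

theorem patternSyncs_iff (A : SemiAutomaton α (Fin n)) (e : Fin k → α)
    (P : List (Fin k × Bool)) :
    patternSyncs (fun q j => A.step q (e j)) P = true ↔ A.IsSyncWord (patternWord e n P) := by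
  -- The machine counts the bits `true`; this is the cardinality of the set they represent.
  have hcount : ∀ y : Fin n → Bool,
      ((List.finRange n).map y).count true = {p | y p = true}.ncard := by
    intro y
    have hset : {p | y p = true} = (((List.finRange n).filter y).toFinset : Set (Fin n)) := by
      ext p; simp
    rw [hset, Set.ncard_coe_finset,
      List.toFinset_card_of_nodup ((List.nodup_finRange n).filter y), List.count, List.countP_map,
      List.countP_eq_length_filter]
    congr 2
    funext p
    simp
  rw [patternSyncs, decide_eq_true_eq, hcount, patternSet_eq, SemiAutomaton.IsSyncWord]
  simp [Set.range]

end SyncMachine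

/-! ### The main theorem -/

/-- For a fixed regular language the constrained synchronization problem for commutative
semi-automata is solvable in polynomial time. The machine tests the finitely many patterns that
are obtained from the language by `exists_patterns`. -/
theorem mainTheorem1 :
    ∃ deg : ℕ → ℕ,
      ∀ (α : Type*) [Fintype α] (e : Fin (Fintype.card α) ≃ α) (L : Language α), L.IsRegular →
        ∃ (M : BoolTuringMachine) (C : ℕ),
          ∀ (n : ℕ) (A : SemiAutomaton α (Fin n)), A.IsCommutative →
            ∃ b : Bool, (b = true ↔ A.HasSyncWordIn L) ∧
              M.AnswersInTime (A.encode e) b (C * (n + 1) ^ deg (Fintype.card α)) := by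
  refine ⟨fun _ => 3, fun α _ e L _ => ?_⟩
  obtain ⟨Ps, hPs⟩ := exists_patterns e L
  refine ⟨(SyncMachine.main Ps).machine .table ⟨none, none, none, none, false⟩,
    SyncMachine.trialsTime Ps + 2 * Fintype.card α + 21, fun n A hA =>
    ⟨Ps.any (SyncMachine.patternSyncs fun q j => A.step q (e j)), ?_, ?_⟩⟩
  · simp only [hPs n A hA, List.any_eq_true, SyncMachine.patternSyncs_iff]
  · have hrun := (SyncMachine.runs_main Ps fun q j => A.step q (e j)).answersInTime
    -- `A.encode e` unfolds to the input `block n ++ rows _ _` of `runs_main`. The halting step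
    -- raises the constant from 20 to 21.
    refine StackProgram.evalsToInTime_mono hrun ?_
    have : 1 ≤ (n + 1) ^ 3 := Nat.one_le_pow _ _ (by omega)
    change (_ + 20) * (n + 1) ^ 3 + 1 ≤ (_ + 20 + 1) * (n + 1) ^ 3
    rw [add_mul _ 1 ((n + 1) ^ 3), one_mul]
    omega
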